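/- All groups are abelian and written additively. A torsion group is *elementary* if for every prime $p$ its $p$-primary component is annihilated by $p$. A group $G$ is *Bassian* if $N=\{0\}$ for every subgroup $N$ of $G$ such that there is an injective homomorphism $G\to G/N$; it is *generalized Bassian* if every subgroup $N$ of $G$ such that there is an injective homomorphism $G\to G/N$ is a direct summand of $G$. A group is a *B+E-group* if it is the direct sum of a Bassian group and an elementary group. **Theorem.** Suppose $G=A\oplus E$ is a B+E-group, where $E$ is elementary and every elementary direct summand of $A$ is finite. Then $G$ is generalized Bassian. -/

import Mathlib

/-- An abelian group is elementary if it is torsion and, for every prime `p`, its `p`-primary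
component is annihilated by `p`. -/
def IsElementaryGroup (E : Type*) [AddCommGroup E] : Prop :=
  IsAddTorsion E ∧
    ∀ p : ℕ, p.Prime → ∀ x ∈ AddCommGroup.primaryComponent E p, p • x = 0

/-- The subgroup `N` is a direct summand of the abelian group `G`: there is a subgroup `K` with
`N ⊓ K = ⊥` and `N ⊔ K = ⊤`. -/
def IsDirectSummand {G : Type*} [AddCommGroup G] (N : AddSubgroup G) : Prop :=
  ∃ K : AddSubgroup G, IsCompl N K

/-- An abelian group `G` is Bassian if an injective homomorphism `G → G ⧸ N` exists only for the
trivial subgroup `N`. -/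
def IsBassian (G : Type*) [AddCommGroup G] : Prop :=
  ∀ N : AddSubgroup G, (∃ f : G →+ G ⧸ N, Function.Injective f) → N = ⊥

/-- An abelian group `G` is generalized Bassian if an injective homomorphism `G → G ⧸ N` exists
only for subgroups `N` that are direct summands of `G`. -/
def IsGeneralizedBassian (G : Type*) [AddCommGroup G] : Prop :=
  ∀ N : AddSubgroup G, (∃ f : G →+ G ⧸ N, Function.Injective f) → IsDirectSummand N

/-- A B+E-group is the direct sum of a Bassian group and an elementary group. -/
def IsBPlusEGroup (G : Type*) [AddCommGroup G] : Prop :=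
  ∃ B E : AddSubgroup G, IsCompl B E ∧ IsBassian B ∧ IsElementaryGroup E

/-! ### Elementary groups: semisimplicity and splitting criteria. -/

section Elementary

/-! Subgroups of elementary groups split off, so `N` is a summand of `G` once some homomorphism from
`G` to an elementary group is injective on `N` (`isDirectSummand_of_disjoint_ker`). The target is
`(G ⧸ A) × (G ⧸ mG)` for a suitable squarefree `m`; what must be shown is `N ∩ A ∩ mG = 0`.

Finite rank of `G` makes `N` torsion, so only elements of prime order `p` matter. They are excluded
by pigeonhole (`eq_zero_of_injective_of_finite`): if `f` carries a finite set `X` containing `0`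
into the image of `X` in `G ⧸ N`, then `X` meets `N` only in `0`. The `p`-primary part of `pG` is
always such an `X`, which settles `p ∣ m`. The set `A[p]` is finite too, but `f` may move it out of
`(N + A)/N`. By `finite_map_of_finite_elementary_summands` the squarefree torsion of `A` has finite
image in `G ⧸ (N + A)`, of order `M` say, so `A[p]` works whenever `p ∤ M`. Taking `m` to be the
product of the primes dividing `M` covers all cases.

These arguments need Bassian groups to have finite rank and finite primary components. Otherwise the
group embeds in its quotient by a nonzero subgroup, constructed with `not_isBassian_of_pair`. -/

theorem isElementaryGroup_iff {E : Type*} [AddCommGroup E] :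
    IsElementaryGroup E ↔ ∀ x : E, ∃ m : ℕ, Squarefree m ∧ m • x = 0 := by
  constructor
  · rintro ⟨ht, hp⟩ x
    refine ⟨addOrderOf x, ?_, addOrderOf_nsmul_eq_zero x⟩
    have hpos : 0 < addOrderOf x := (ht x).addOrderOf_pos
    rw [Nat.squarefree_iff_prime_squarefree]
    rintro p hpp ⟨t, ht'⟩
    have h1 : p • (t • x) = 0 := by
      apply hp p hpp
      rw [AddCommGroup.mem_primaryComponent]
      refine ⟨2, ?_⟩
      rw [smul_smul, pow_two, ← ht', addOrderOf_nsmul_eq_zero]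
    rw [smul_smul] at h1
    have h2 := Nat.le_of_dvd (Nat.pos_of_ne_zero ?_) (addOrderOf_dvd_of_nsmul_eq_zero h1)
    · have := hpp.two_le
      have : 0 < p * t := by
        rcases Nat.eq_zero_or_pos (p * t) with h | h
        · rw [mul_assoc, h] at ht'; omega
        · exact h
      nlinarith
    · intro h
      rw [mul_assoc, h] at ht'; omega
  · intro h
    refine ⟨fun x => ?_, fun p hp x hx => ?_⟩
    · obtain ⟨m, hm, hx⟩ := h x
      exact isOfFinAddOrder_iff_nsmul_eq_zero.2 ⟨m, Nat.pos_of_ne_zero hm.ne_zero, hx⟩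
    · obtain ⟨k, hk⟩ := AddCommGroup.mem_primaryComponent.1 hx
      obtain ⟨m, hm, hmx⟩ := h x
      have h1 := addOrderOf_dvd_of_nsmul_eq_zero hk
      have h2 := addOrderOf_dvd_of_nsmul_eq_zero hmx
      obtain ⟨j, -, hj⟩ := (Nat.dvd_prime_pow hp).1 h1
      have hsq : Squarefree (p ^ j) := hj ▸ hm.squarefree_of_dvd h2
      have hj1 : j ≤ 1 := by
        by_contra hj2
        have := hsq p ⟨p ^ (j - 2), by rw [← pow_two, ← pow_add]; congr 1; omega⟩
        exact hp.not_isUnit this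
      apply addOrderOf_dvd_iff_nsmul_eq_zero.1
      rw [hj]
      simpa using pow_dvd_pow p hj1

theorem IsElementaryGroup.of_injective {E F : Type*} [AddCommGroup E] [AddCommGroup F]
    (hF : IsElementaryGroup F) (f : E →+ F) (hf : Function.Injective f) : IsElementaryGroup E := by
  rw [isElementaryGroup_iff] at *
  intro x
  obtain ⟨m, hm, hx⟩ := hF (f x)
  exact ⟨m, hm, hf (by simpa using hx)⟩

theorem IsElementaryGroup.of_surjective {E F : Type*} [AddCommGroup E] [AddCommGroup F]
    (hE : IsElementaryGroup E) (f : E →+ F) (hf : Function.Surjective f) :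
    IsElementaryGroup F := by
  rw [isElementaryGroup_iff] at *
  intro x
  obtain ⟨y, rfl⟩ := hf x
  obtain ⟨m, hm, hx⟩ := hE y
  exact ⟨m, hm, by rw [← map_nsmul, hx, map_zero]⟩

theorem IsElementaryGroup.prod {E F : Type*} [AddCommGroup E] [AddCommGroup F]
    (hE : IsElementaryGroup E) (hF : IsElementaryGroup F) : IsElementaryGroup (E × F) := by
  refine ⟨fun x => ?_, fun p hp x hx => ?_⟩
  · obtain ⟨a, ha, ha'⟩ := isOfFinAddOrder_iff_nsmul_eq_zero.1 (hE.1 x.1)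
    obtain ⟨b, hb, hb'⟩ := isOfFinAddOrder_iff_nsmul_eq_zero.1 (hF.1 x.2)
    refine isOfFinAddOrder_iff_nsmul_eq_zero.2 ⟨a * b, Nat.mul_pos ha hb, Prod.ext ?_ ?_⟩
    · simp [mul_comm a b, mul_smul, ha']
    · simp [mul_smul, hb']
  · obtain ⟨k, hk⟩ := AddCommGroup.mem_primaryComponent.1 hx
    refine Prod.ext (hE.2 p hp _ ?_) (hF.2 p hp _ ?_)
    · exact AddCommGroup.mem_primaryComponent.2 ⟨k, congrArg Prod.fst hk⟩
    · exact AddCommGroup.mem_primaryComponent.2 ⟨k, congrArg Prod.snd hk⟩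

theorem isElementaryGroup_of_squarefree {E : Type*} [AddCommGroup E] {m : ℕ} (hm : Squarefree m)
    (h : ∀ x : E, m • x = 0) : IsElementaryGroup E :=
  isElementaryGroup_iff.2 fun x => ⟨m, hm, h x⟩

theorem span_singleton_isAtom {W : Type*} [AddCommGroup W] {p : ℕ} (hp : p.Prime) {x : W}
    (hx : x ≠ 0) (hpx : p • x = 0) : IsAtom (Submodule.span ℤ {x}) := by
  refine ⟨by simpa using hx, fun Y hY => ?_⟩
  by_contra hne
  obtain ⟨y, hy, hy0⟩ := (Submodule.ne_bot_iff Y).1 hne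
  obtain ⟨c, rfl⟩ := Submodule.mem_span_singleton.1 (hY.le hy)
  have hpz : (p : ℤ) • x = 0 := by simpa using hpx
  have hc : ¬ (p : ℤ) ∣ c := by
    rintro ⟨d, rfl⟩
    exact hy0 (by rw [mul_comm, mul_smul, hpz, smul_zero])
  obtain ⟨a, b, hab⟩ := ((Nat.prime_iff_prime_int.1 hp).coprime_iff_not_dvd.2 hc)
  refine hY.not_ge ((Submodule.span_singleton_le_iff_mem _ _).2 ?_)
  have : x = b • c • x := by
    conv_lhs => rw [← one_smul ℤ x, ← hab, add_smul, mul_smul, hpz, smul_zero, zero_add, mul_smul]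
  rw [this]
  exact Y.smul_mem b hy

/-- Bézout splits an element killed by a squarefree number into elements of prime order, and these
span atoms. -/
theorem sSup_atoms_eq_top_of_squarefree {W : Type*} [AddCommGroup W]
    (hW : ∀ x : W, ∃ m : ℕ, Squarefree m ∧ m • x = 0) :
    sSup {a : Submodule ℤ W | IsAtom a} = ⊤ := by
  rw [eq_top_iff]
  rintro x -
  obtain ⟨m, hm, hx⟩ := hW x
  induction m using Nat.recOnMul generalizing x with
  | zero => exact absurd rfl hm.ne_zero
  | one => rw [one_smul] at hx; rw [hx]; exact zero_mem _
  | prime p hp =>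
    by_cases h0 : x = 0
    · rw [h0]; exact zero_mem _
    · exact (le_sSup (a := Submodule.span ℤ {x}) (span_singleton_isAtom hp h0 hx))
        (Submodule.mem_span_singleton_self x)
  | mul a b iha ihb =>
    obtain ⟨hab, ha, hb⟩ := Nat.squarefree_mul_iff.1 hm
    have h1 := iha (x := b • x) ha (by rw [smul_smul, hx])
    have h2 := ihb (x := a • x) hb (by rw [smul_smul, mul_comm, hx])
    obtain ⟨u, v, huv⟩ := Nat.isCoprime_iff_coprime.2 hab
    have : x = u • a • x + v • b • x := by
      rw [← natCast_zsmul, ← natCast_zsmul x b, smul_smul, smul_smul, ← add_smul, huv, one_smul]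
    rw [this]
    exact add_mem (Submodule.smul_mem _ _ h2) (Submodule.smul_mem _ _ h1)

theorem IsElementaryGroup.isDirectSummand {W : Type*} [AddCommGroup W]
    (hW : IsElementaryGroup W) (X : AddSubgroup W) : IsDirectSummand X := by
  have := complementedLattice_of_sSup_atoms_eq_top
    (sSup_atoms_eq_top_of_squarefree (isElementaryGroup_iff.1 hW))
  obtain ⟨K, hK⟩ := this.exists_isCompl (AddSubgroup.toIntSubmodule X)
  exact ⟨AddSubgroup.toIntSubmodule.symm K,
    (AddSubgroup.toIntSubmodule (M := W)).isCompl_iff.2 (by simpa using hK)⟩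

theorem isDirectSummand_of_disjoint_ker {G W : Type*} [AddCommGroup G] [AddCommGroup W]
    (hW : IsElementaryGroup W) (φ : G →+ W) (N : AddSubgroup G)
    (h : ∀ x ∈ N, φ x = 0 → x = 0) : IsDirectSummand N := by
  obtain ⟨K, hK⟩ := hW.isDirectSummand (N.map φ)
  refine ⟨K.comap φ, ?_, ?_⟩
  · rw [AddSubgroup.disjoint_def]
    intro x hx hxK
    exact h x hx (AddSubgroup.disjoint_def.1 hK.disjoint (AddSubgroup.mem_map_of_mem φ hx) hxK)
  · rw [codisjoint_iff, eq_top_iff]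
    rintro x -
    have : φ x ∈ N.map φ ⊔ K := by rw [hK.sup_eq_top]; trivial
    obtain ⟨y, ⟨n, hn, rfl⟩, k, hk, hyk⟩ := AddSubgroup.mem_sup.1 this
    refine AddSubgroup.mem_sup.2 ⟨n, hn, x - n, ?_, by abel⟩
    rw [AddSubgroup.mem_comap, map_sub, ← hyk, add_sub_cancel_left]
    exact hk

/-- A complement `K` of `S ∩ ker φ` in `S` has the same image as `S`. As `φ` is injective on `K`,
this `K` is an elementary summand of `A`, hence finite. -/
theorem finite_map_of_finite_elementary_summands {A W : Type*} [AddCommGroup A] [AddCommGroup W]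
    (hA : ∀ S : AddSubgroup A, IsElementaryGroup S → IsDirectSummand S → Finite S)
    (hW : IsElementaryGroup W) (φ : A →+ W) (S : AddSubgroup A) (hS : IsElementaryGroup S) :
    Finite (S.map φ) := by
  obtain ⟨K, hK⟩ := hS.isDirectSummand (φ.comp S.subtype).ker
  have hS' : IsElementaryGroup (K.map S.subtype) :=
    hS.of_injective (AddSubgroup.inclusion (AddSubgroup.map_subtype_le K))
      (AddSubgroup.inclusion_injective _)
  have := hA (K.map S.subtype) hS' (isDirectSummand_of_disjoint_ker hW φ _ ?_)
  · have hsub : S.map φ = (K.map S.subtype).map φ := by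
      apply le_antisymm
      · rintro _ ⟨s, hs, rfl⟩
        have : (⟨s, hs⟩ : S) ∈ (φ.comp S.subtype).ker ⊔ K := by rw [hK.sup_eq_top]; trivial
        obtain ⟨y, hy, k, hk, hyk⟩ := AddSubgroup.mem_sup.1 this
        refine ⟨k, ⟨k, hk, rfl⟩, ?_⟩
        have h1 : s = y + k := congrArg Subtype.val hyk.symm
        have h2 : φ y = 0 := hy
        rw [h1, map_add, h2, zero_add]
      · exact AddSubgroup.map_mono (AddSubgroup.map_subtype_le K)
    rw [hsub]
    have h := Set.toFinite ((K.map S.subtype : AddSubgroup A) : Set A)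
    exact (h.image φ).to_subtype
  · rintro _ ⟨k, hk, rfl⟩ h0
    have : k = 0 := AddSubgroup.disjoint_def.1 hK.disjoint (x := k) h0 hk
    simp [this]

end Elementary

/-! ### Constructing embeddings into quotients by nonzero subgroups. -/

section NotBassian

/-- With `s` a section of `σ` having values in `P`, the map `b ↦ b + s (ι b - σ b)` embeds `B` in `B
⧸ (P ⊓ ker σ)`: an element `b` of its kernel lies in `P`, and applying `σ` leaves `ι b = 0`. -/
theorem not_isBassian_of_pair {B D : Type*} [AddCommGroup B] [AddCommGroup D] (σ ι : B →+ D)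
    (P : AddSubgroup B) (hσ : ∀ d, ∃ x ∈ P, σ x = d) (hι : ∀ x ∈ P, ι x = 0 → x = 0)
    (hN : ∃ x ∈ P, x ≠ 0 ∧ σ x = 0) : ¬ IsBassian B := by
  intro hB
  obtain ⟨x, hxP, hx0, hσx⟩ := hN
  choose s hsP hs using hσ
  have hbot := hB (P ⊓ σ.ker) ?_
  · exact hx0 ((AddSubgroup.eq_bot_iff_forall _).1 hbot x ⟨hxP, hσx⟩)
  -- The set-theoretic section is additive modulo `P ⊓ ker σ`.
  let j : D →+ B ⧸ (P ⊓ σ.ker) := AddMonoidHom.mk' (fun d => (s d : B ⧸ (P ⊓ σ.ker))) <| by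
    intro d e
    rw [← QuotientAddGroup.mk_add, QuotientAddGroup.eq]
    refine AddSubgroup.mem_inf.2
      ⟨add_mem (neg_mem (hsP _)) (add_mem (hsP _) (hsP _)), AddMonoidHom.mem_ker.2 ?_⟩
    simp [hs]
  refine ⟨QuotientAddGroup.mk' _ + j.comp (ι - σ), (injective_iff_map_eq_zero _).2 fun b hb => ?_⟩
  have hb' : ((b + s (ι b - σ b) : B) : B ⧸ (P ⊓ σ.ker)) = 0 := hb
  rw [QuotientAddGroup.eq_zero_iff, AddSubgroup.mem_inf] at hb'
  have h1 : b ∈ P := by simpa using sub_mem hb'.1 (hsP (ι b - σ b))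
  have h2 : σ (b + s (ι b - σ b)) = 0 := hb'.2
  rw [map_add, hs, add_sub_cancel] at h2
  exact hι b h1 h2

theorem exists_extension_of_ker_le {F B D : Type*} [AddCommGroup F] [AddCommGroup B]
    [AddCommGroup D] (Φ : F →+ B) (Ψ : F →+ D)
    (hext : ∀ g : Φ.range →+ D, ∃ h : B →+ D, ∀ x : Φ.range, h x = g x)
    (hker : ∀ c, Φ c = 0 → Ψ c = 0) : ∃ h : B →+ D, ∀ c, h (Φ c) = Ψ c := by
  let g : Φ.range →+ D := (Φ.rangeRestrict).liftOfSurjective Φ.rangeRestrict_surjective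
    ⟨Ψ, fun c hc => hker c (congrArg Subtype.val hc)⟩
  obtain ⟨h, hh⟩ := hext g
  refine ⟨h, fun c => ?_⟩
  have := hh (Φ.rangeRestrict c)
  rw [AddMonoidHom.coe_rangeRestrict] at this
  rw [this]
  exact AddMonoidHom.liftOfRightInverse_comp_apply _ _ _ _ _

open Finsupp in
-- The `x i` span `⨁ ℤ/n i` (with `n i = 0` giving `ℤ`), and so do the `u i` in `D`. Sending `x i`
-- to `u i` gives `ι`; sending the `x i` onto an enumeration of `D` that kills `x 0` gives `σ`.
theorem not_isBassian_of_sequence {B D : Type*} [AddCommGroup B] [AddCommGroup D] [Countable D]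
    (x : ℕ → B) (u : ℕ → D) (n : ℕ → ℕ) (hn : n 0 ≠ 1)
    (hx : ∀ c : ℕ →₀ ℤ, linearCombination ℤ x c = 0 ↔ ∀ i, (n i : ℤ) ∣ c i)
    (hu : ∀ c : ℕ →₀ ℤ, linearCombination ℤ u c = 0 ↔ ∀ i, (n i : ℤ) ∣ c i)
    (hD : ∀ d : D, ∃ k, ∀ i ≥ k, n i • d = 0)
    (hext : ∀ g : (linearCombination ℤ x).toAddMonoidHom.range →+ D,
      ∃ h : B →+ D, ∀ y : (linearCombination ℤ x).toAddMonoidHom.range, h y = g y) :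
    ¬ IsBassian B := by
  classical
  obtain ⟨e, he⟩ := exists_surjective_nat D
  -- Unpairing proposes each element of `D` at infinitely many indices, hence at one where `n i`
  -- kills it; index `0` is reserved for the kernel.
  let v : ℕ → D := fun i => if n i • e (Nat.unpair i).1 = 0 ∧ i ≠ 0 then e (Nat.unpair i).1 else 0
  have hv : ∀ i, n i • v i = 0 := by
    intro i
    by_cases h : n i • e (Nat.unpair i).1 = 0 ∧ i ≠ 0
    · simp only [v, if_pos h, h.1]
    · simp only [v, if_neg h, smul_zero]
  obtain ⟨ι, hι⟩ := exists_extension_of_ker_le (linearCombination ℤ x).toAddMonoidHom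
    (linearCombination ℤ u).toAddMonoidHom hext (fun c hc => (hu c).2 ((hx c).1 hc))
  obtain ⟨σ, hσ⟩ := exists_extension_of_ker_le (linearCombination ℤ x).toAddMonoidHom
    (linearCombination ℤ v).toAddMonoidHom hext (fun c hc => by
      have h1 := (hx c).1 hc
      show linearCombination ℤ v c = 0
      rw [linearCombination_apply]
      refine Finset.sum_eq_zero fun i _ => ?_
      obtain ⟨t, ht⟩ := h1 i
      simp only [ht]
      rw [mul_comm, mul_smul, natCast_zsmul, hv, smul_zero])
  have hxi : ∀ i, (linearCombination ℤ x).toAddMonoidHom (single i 1) = x i := fun i => by simp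
  refine not_isBassian_of_pair σ ι (linearCombination ℤ x).toAddMonoidHom.range ?_ ?_ ?_
  · intro d
    obtain ⟨a, rfl⟩ := he d
    obtain ⟨k, hk⟩ := hD (e a)
    let i := Nat.pair a (k + 1)
    have hi : k + 1 ≤ i := Nat.right_le_pair _ _
    refine ⟨x i, ⟨single i 1, hxi i⟩, ?_⟩
    rw [← hxi, hσ]
    have hi1 : (Nat.unpair i).1 = a := by simp [i]
    have : v i = e a := by
      simp only [v, hi1]
      rw [if_pos ⟨hk i (by omega), by omega⟩]
    simp [this]
  · rintro _ ⟨c, rfl⟩ hc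
    rw [hι] at hc
    exact (hx c).2 ((hu c).1 hc)
  · refine ⟨x 0, ⟨single 0 1, hxi 0⟩, fun h0 => ?_, ?_⟩
    · have := (hx (single 0 1)).1 (by simp [h0]) 0
      rw [single_eq_same] at this
      exact hn (by simpa [Int.natCast_dvd] using this)
    · rw [← hxi, hσ]
      simp [v]

theorem exists_extension_of_divisible {B D : Type*} [AddCommGroup B] [AddCommGroup D]
    (hD : ∀ n : ℕ, n ≠ 0 → ∀ d : D, ∃ y : D, n • y = d) (P : AddSubgroup B) (g : P →+ D) :
    ∃ h : B →+ D, ∀ x : P, h x = g x := by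
  have hD' : ∀ n : ℤ, n ≠ 0 → Function.Surjective (fun y : D => n • y) := by
    intro n hn d
    obtain ⟨y, hy⟩ := hD n.natAbs (by simpa using hn) d
    rcases Int.natAbs_eq n with h | h
    · exact ⟨y, by simp only; rw [h, natCast_zsmul, hy]⟩
    · exact ⟨-y, by simp only; rw [h, neg_smul, smul_neg, neg_neg, natCast_zsmul, hy]⟩
  let : DivisibleBy D ℤ := divisibleByOfSMulRightSurj D ℤ (fun {n} hn => hD' n hn)
  obtain ⟨h, hh⟩ := (Module.Baer.of_divisible D).extension_property_addMonoidHom P.subtype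
    P.subtype_injective g
  exact ⟨h, fun x => DFunLike.congr_fun hh x⟩

theorem divisible_of_primary {V : Type*} [AddCommGroup V] {p : ℕ} (hp : p.Prime)
    (ht : ∀ x : V, ∃ k : ℕ, p ^ k • x = 0) (hs : ∀ x : V, ∃ y, p • y = x) (n : ℕ) (hn : n ≠ 0)
    (d : V) : ∃ y : V, n • y = d := by
  have hpow : ∀ (b : ℕ) (x : V), ∃ y, p ^ b • y = x := by
    intro b
    induction b with
    | zero => exact fun x => ⟨x, by simp⟩
    | succ b ih =>
      intro x
      obtain ⟨y, rfl⟩ := hs x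
      obtain ⟨z, rfl⟩ := ih y
      exact ⟨z, by rw [pow_succ, mul_comm, mul_smul]⟩
  obtain ⟨b, m, hm, rfl⟩ := Nat.exists_eq_pow_mul_and_not_dvd hn p hp.ne_one
  obtain ⟨k, hk⟩ := ht d
  obtain ⟨u, v, huv⟩ : IsCoprime (m : ℤ) ((p ^ k : ℕ) : ℤ) := Nat.isCoprime_iff_coprime.2
    (((Nat.Prime.coprime_iff_not_dvd hp).2 hm).symm.pow_right k)
  obtain ⟨y, hy⟩ := hpow b (u • d)
  refine ⟨y, ?_⟩
  rw [mul_comm, mul_smul, hy]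
  conv_rhs => rw [← one_smul ℤ d, ← huv, add_smul, mul_smul v, natCast_zsmul, hk, smul_zero,
    add_zero, mul_comm, mul_smul, natCast_zsmul]

end NotBassian

/-! ### Independent sequences of prescribed height. -/

section Sequences

open Finsupp

theorem exists_mem_notMem_sup_closure {B : Type*} [AddCommGroup B] {p : ℕ} (hp : p.Prime)
    (H W : AddSubgroup B) (hW : ∀ w ∈ W, p • w = 0) (hinf : (W : Set B).Infinite)
    (hH : {w | w ∈ H ∧ p • w = 0}.Finite) (s : Finset B) (hs : ∀ x ∈ s, p • x = 0) :
    ∃ y ∈ W, y ∉ H ⊔ AddSubgroup.closure (s : Set B) := by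
  by_contra! hcon
  have hclos : ∀ x ∈ AddSubgroup.closure (s : Set B), p • x = 0 := by
    intro x hx
    have : AddSubgroup.closure (s : Set B) ≤ (nsmulAddMonoidHom (α := B) p).ker :=
      (AddSubgroup.closure_le _).2 fun y hy => hs y hy
    exact this hx
  have hfg : AddGroup.FG (AddSubgroup.closure (s : Set B)) :=
    (AddGroup.fg_iff_addSubgroup_fg _).2 ⟨s, rfl⟩
  have hfin : Finite (AddSubgroup.closure (s : Set B)) :=
    AddCommGroup.finite_of_fg_isAddTorsion _ fun x =>
      isOfFinAddOrder_iff_nsmul_eq_zero.2 ⟨p, hp.pos, Subtype.ext (hclos x x.2)⟩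
  refine hinf ((hH.add (Set.toFinite (AddSubgroup.closure (s : Set B) : Set B))).subset ?_)
  intro w hw
  obtain ⟨h, hh, t, ht, rfl⟩ := AddSubgroup.mem_sup.1 (hcon w hw)
  refine ⟨h, ⟨hh, ?_⟩, t, ht, rfl⟩
  have := hW _ hw
  rwa [smul_add, hclos t ht, add_zero] at this

/-- Each `y i` is chosen outside `H` plus the span of its predecessors. In a relation modulo `H`,
the last coefficient prime to `p` would contradict that choice. -/
theorem exists_independent_seq {B : Type*} [AddCommGroup B] {p : ℕ} (hp : p.Prime)
    (H : AddSubgroup B) (W : ℕ → AddSubgroup B) (hW : ∀ i, ∀ w ∈ W i, p • w = 0)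
    (hinf : ∀ i, (W i : Set B).Infinite) (hH : {w | w ∈ H ∧ p • w = 0}.Finite) :
    ∃ y : ℕ → B, (∀ i, y i ∈ W i) ∧
      ∀ c : ℕ →₀ ℤ, linearCombination ℤ y c ∈ H → ∀ i, (p : ℤ) ∣ c i := by
  classical
  have hpick : ∀ (i : ℕ) (s : {s : Finset B // ∀ x ∈ s, p • x = 0}),
      ∃ y ∈ W i, y ∉ H ⊔ AddSubgroup.closure ((s : Finset B) : Set B) := fun i s =>
    exists_mem_notMem_sup_closure hp H (W i) (hW i) (hinf i) hH s.1 s.2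
  choose pick hpickW hpickH using hpick
  let S : ℕ → {s : Finset B // ∀ x ∈ s, p • x = 0} := fun i =>
    Nat.rec ⟨∅, by simp⟩ (fun i s => ⟨insert (pick i s) s.1, by
      intro x hx
      rcases Finset.mem_insert.1 hx with rfl | hx
      · exact hW i _ (hpickW i s)
      · exact s.2 x hx⟩) i
  have hS : ∀ i, (S (i + 1)).1 = insert (pick i (S i)) (S i).1 := fun i => rfl
  have hmem : ∀ i j, j < i → pick j (S j) ∈ (S i).1 := by
    intro i
    induction i with
    | zero => intro j hj; omega
    | succ i ih =>
      intro j hj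
      rw [hS, Finset.mem_insert]
      rcases Nat.lt_succ_iff_lt_or_eq.1 hj with h | rfl
      · exact Or.inr (ih j h)
      · exact Or.inl rfl
  refine ⟨fun i => pick i (S i), fun i => hpickW i _, fun c hc => ?_⟩
  by_contra! hcon
  obtain ⟨i, hi⟩ := hcon
  have hne : (c.support.filter fun i => ¬ (p : ℤ) ∣ c i).Nonempty :=
    ⟨i, Finset.mem_filter.2 ⟨mem_support_iff.2 fun h => hi (h ▸ dvd_zero _), hi⟩⟩
  obtain ⟨hm, hmax⟩ : _ ∧ ∀ j ∈ c.support.filter fun i => ¬ (p : ℤ) ∣ c i, j ≤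
      (c.support.filter fun i => ¬ (p : ℤ) ∣ c i).max' hne :=
    ⟨Finset.max'_mem _ hne, fun j hj => Finset.le_max' _ j hj⟩
  generalize (c.support.filter fun i => ¬ (p : ℤ) ∣ c i).max' hne = m at hm hmax
  obtain ⟨hmc, hmp⟩ := Finset.mem_filter.1 hm
  set U := H ⊔ AddSubgroup.closure ((S m).1 : Set B)
  have hpy : ∀ j, p • pick j (S j) = 0 := fun j => hW j _ (hpickW j _)
  have h1 : c m • pick m (S m) ∈ U := by
    rw [linearCombination_apply, Finsupp.sum, ← Finset.add_sum_erase _ _ hmc] at hc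
    have h2 : ∑ j ∈ c.support.erase m, c j • pick j (S j) ∈ U := by
      refine sum_mem fun j hj => ?_
      obtain ⟨hjm, hjc⟩ := Finset.mem_erase.1 hj
      by_cases hpj : (p : ℤ) ∣ c j
      · obtain ⟨t, ht⟩ := hpj
        rw [ht, mul_comm, mul_smul, natCast_zsmul, hpy, smul_zero]
        exact zero_mem _
      · have : j ≤ m := hmax j (Finset.mem_filter.2 ⟨hjc, hpj⟩)
        exact AddSubgroup.mem_sup_right (zsmul_mem
          (AddSubgroup.subset_closure (hmem m j (by omega))) _)
    simpa using sub_mem (AddSubgroup.mem_sup_left (T := AddSubgroup.closure ((S m).1 : Set B)) hc) h2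
  obtain ⟨a, b, hab⟩ := (Nat.prime_iff_prime_int.1 hp).coprime_iff_not_dvd.2 hmp
  apply hpickH m (S m)
  have : pick m (S m) = b • c m • pick m (S m) := by
    conv_lhs => rw [← one_smul ℤ (pick m (S m)), ← hab, add_smul, mul_smul, natCast_zsmul, hpy,
      smul_zero, zero_add, mul_smul]
  rw [this]
  exact zsmul_mem h1 b

theorem prime_pow_dvd_of_linearCombination_mem {B : Type*} [AddCommGroup B] {p : ℕ} (hp : p.Prime)
    (H : AddSubgroup B) (x y : ℕ → B) (e : ℕ → ℕ) (hxy : ∀ i, p ^ e i • x i = y i)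
    (hy : ∀ c : ℕ →₀ ℤ, linearCombination ℤ y c ∈ H → ∀ i, (p : ℤ) ∣ c i)
    (c : ℕ →₀ ℤ) (hc : linearCombination ℤ x c ∈ H) (i : ℕ) :
    ((p ^ (e i + 1) : ℕ) : ℤ) ∣ c i := by
  have hp0 : (p : ℤ) ≠ 0 := by exact_mod_cast hp.ne_zero
  -- Descent on `s`: with `p ^ s * c i = p ^ e i * t i`, the sum of the `t i • y i` is `p ^ s` times
  -- the given element of `H`, so `p` divides every `t i`.
  have hstep : ∀ s : ℕ, (∀ i, (p : ℤ) ^ (e i + 1) ∣ (p : ℤ) ^ s * c i) →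
      ∀ i, (p : ℤ) ^ (e i + 1) ∣ c i := by
    intro s
    induction s with
    | zero => simp
    | succ s ih =>
      intro h
      apply ih
      have h1 : ∀ i, (p : ℤ) ^ e i ∣ (p : ℤ) ^ s * c i := fun i => by
        have := h i
        rw [pow_succ', pow_succ', mul_assoc] at this
        exact (mul_dvd_mul_iff_left hp0).1 this
      choose t ht using h1
      have hsupp : ∀ i, t i ≠ 0 → i ∈ c.support := by
        intro i hi
        rw [mem_support_iff]
        intro h0
        have := ht i
        rw [h0, mul_zero, eq_comm, mul_eq_zero] at this
        exact this.elim (pow_ne_zero _ hp0) hi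
      have h2 := hy (Finsupp.onFinset c.support t hsupp) ?_
      · intro i
        obtain ⟨r, hr⟩ := h2 i
        rw [onFinset_apply] at hr
        exact ⟨r, by rw [ht, hr]; ring⟩
      · have : linearCombination ℤ y (Finsupp.onFinset c.support t hsupp) =
            (p : ℤ) ^ s • linearCombination ℤ x c := by
          rw [linearCombination_onFinset, linearCombination_apply, Finsupp.sum, Finset.smul_sum]
          refine Finset.sum_congr rfl fun i _ => ?_
          rw [smul_smul, ht, ← hxy, mul_comm, mul_smul, ← natCast_zsmul]
          push_cast
          rfl
        rw [this]
        exact zsmul_mem hc _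
  push_cast
  refine hstep (c.support.sup fun i => e i + 1) (fun i => ?_) i
  by_cases hi : i ∈ c.support
  · exact dvd_mul_of_dvd_left (pow_dvd_pow _ (Finset.le_sup (f := fun i => e i + 1) hi)) _
  · rw [notMem_support_iff.1 hi, mul_zero]
    exact dvd_zero _

theorem linearCombination_eq_zero_of_dvd {B : Type*} [AddCommGroup B] (x : ℕ → B) (n : ℕ → ℕ)
    (hn : ∀ i, n i • x i = 0) (c : ℕ →₀ ℤ) (hc : ∀ i, (n i : ℤ) ∣ c i) :
    linearCombination ℤ x c = 0 := by
  rw [linearCombination_apply]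
  refine Finset.sum_eq_zero fun i _ => ?_
  obtain ⟨t, ht⟩ := hc i
  simp only [ht]
  rw [mul_comm, mul_smul, natCast_zsmul, hn, smul_zero]

theorem linearCombination_single_eq_zero_iff {M : Type*} [AddCommGroup M] (m : ℕ → M)
    (c : ℕ →₀ ℤ) :
    linearCombination ℤ (fun i => single i (m i)) c = 0 ↔ ∀ i, (addOrderOf (m i) : ℤ) ∣ c i := by
  have key : ∀ i, linearCombination ℤ (fun i => single i (m i)) c i = c i • m i := by
    intro i
    rw [linearCombination_apply, Finsupp.sum, finsetSum_apply]
    by_cases hi : i ∈ c.support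
    · rw [Finset.sum_eq_single_of_mem i hi]
      · simp
      · intro j _ hj
        simp [hj]
    · rw [notMem_support_iff.1 hi, zero_smul]
      refine Finset.sum_eq_zero fun j hj => ?_
      have : j ≠ i := fun h => hi (h ▸ hj)
      simp [this]
  simp_rw [addOrderOf_dvd_iff_zsmul_eq_zero, Finsupp.ext_iff, key]
  rfl

theorem linearCombination_codRestrict_eq_zero_iff {Δ : Type*} [AddCommGroup Δ] (D : AddSubgroup Δ)
    (u : ℕ → Δ) (hu : ∀ i, u i ∈ D) (c : ℕ →₀ ℤ) :
    linearCombination ℤ (fun i => (⟨u i, hu i⟩ : D)) c = 0 ↔ linearCombination ℤ u c = 0 := by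
  rw [← D.subtype_injective.eq_iff, map_zero]
  have := apply_linearCombination ℤ D.subtype.toIntLinearMap (fun i => (⟨u i, hu i⟩ : D)) c
  exact Eq.congr this rfl

end Sequences

/-! ### Finiteness of primary components of Bassian groups. -/

section BassianPrimary

open Finsupp

theorem finsupp_addCircle_divisible (n : ℕ) (hn : n ≠ 0) (d : ℕ →₀ AddCircle (1 : ℚ)) :
    ∃ y, n • y = d := by
  induction d using Finsupp.induction_linear with
  | zero => exact ⟨0, smul_zero _⟩
  | add f g hf hg =>
    obtain ⟨a, rfl⟩ := hf
    obtain ⟨b, rfl⟩ := hg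
    exact ⟨a + b, smul_add _ _ _⟩
  | single i a =>
    refine ⟨single i (DivisibleBy.div a (n : ℤ)), ?_⟩
    rw [smul_single, ← natCast_zsmul, DivisibleBy.div_cancel a (by exact_mod_cast hn)]

theorem countable_addCircle : Countable (AddCircle (1 : ℚ)) :=
  (QuotientAddGroup.mk_surjective (s := AddSubgroup.zmultiples (1 : ℚ))).countable

theorem not_isBassian_of_linearIndependent {B : Type*} [AddCommGroup B] (x : ℕ → B)
    (hx : LinearIndependent ℤ x) : ¬ IsBassian B := by
  refine not_isBassian_of_sequence (D := ℕ →₀ ℚ) x (fun i => single i 1) (fun _ => 0)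
    (by norm_num) (fun c => ?_) (fun c => ?_) (fun d => ⟨0, by simp⟩) (fun g => ?_)
  · constructor
    · intro h i
      simp [linearIndependent_iff.1 hx c h]
    · intro h
      have : c = 0 := Finsupp.ext fun i => by simpa using h i
      simp [this]
  · rw [linearCombination_single_eq_zero_iff]
    have : addOrderOf (1 : ℚ) = 0 := by
      rw [addOrderOf_eq_zero_iff']
      intro n hn
      simpa using hn.ne'
    rw [this]
  · refine exists_extension_of_divisible (fun n hn d => ⟨(n : ℚ)⁻¹ • d, ?_⟩) _ g
    rw [← Nat.cast_smul_eq_nsmul ℚ, smul_smul, mul_inv_cancel₀ (by exact_mod_cast hn), one_smul]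

/-- The elements of order dividing `p` that are divisible by `p ^ k`. -/
def heightSocle (B : Type*) [AddCommGroup B] (p k : ℕ) : AddSubgroup B :=
  (nsmulAddMonoidHom (α := B) p).ker ⊓ (nsmulAddMonoidHom (α := B) (p ^ k)).range

theorem mem_heightSocle {B : Type*} [AddCommGroup B] {p k : ℕ} {w : B} :
    w ∈ heightSocle B p k ↔ p • w = 0 ∧ ∃ b, p ^ k • b = w := Iff.rfl

theorem heightSocle_antitone (B : Type*) [AddCommGroup B] (p : ℕ) :
    Antitone (heightSocle B p) := by
  intro i j hij w hw
  obtain ⟨h1, b, rfl⟩ := mem_heightSocle.1 hw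
  refine mem_heightSocle.2 ⟨h1, p ^ (j - i) • b, ?_⟩
  rw [smul_smul, ← pow_add, Nat.add_sub_cancel' hij]

theorem addOrderOf_one_div_addCircle {n : ℕ} (hn : 0 < n) :
    addOrderOf ((1 / n : ℚ) : AddCircle (1 : ℚ)) = n :=
  haveI : Fact ((0 : ℚ) < 1) := ⟨one_pos⟩
  AddCircle.addOrderOf_period_div hn

theorem exists_smul_eq_of_heightSocle {B : Type*} [AddCommGroup B] {p : ℕ} {e : ℕ → ℕ} {y : ℕ → B}
    (hy : ∀ i, y i ∈ heightSocle B p (e i)) :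
    ∃ x : ℕ → B, (∀ i, p ^ e i • x i = y i) ∧ ∀ i, p ^ (e i + 1) • x i = 0 := by
  choose x hx using fun i => (mem_heightSocle.1 (hy i)).2
  refine ⟨x, hx, fun i => ?_⟩
  rw [pow_succ', mul_smul, hx, (mem_heightSocle.1 (hy i)).1]

theorem not_isBassian_of_infinite_heightSocle {B : Type*} [AddCommGroup B] {p : ℕ} (hp : p.Prime)
    (hinf : ∀ k, (heightSocle B p k : Set B).Infinite) : ¬ IsBassian B := by
  have := countable_addCircle
  obtain ⟨y, hyW, hy⟩ := exists_independent_seq hp ⊥ (heightSocle B p)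
    (fun i w hw => (mem_heightSocle.1 hw).1) hinf
    ((Set.finite_singleton (0 : B)).subset fun w hw => hw.1)
  obtain ⟨x, hxy, hx0⟩ := exists_smul_eq_of_heightSocle (e := fun i => i) hyW
  let Δ := ℕ →₀ AddCircle (1 : ℚ)
  let D : AddSubgroup Δ := AddCommGroup.primaryComponent Δ p
  let u : ℕ → Δ := fun i => single i ((1 / (p ^ (i + 1) : ℕ) : ℚ) : AddCircle (1 : ℚ))
  have hord : ∀ i, addOrderOf ((1 / (p ^ (i + 1) : ℕ) : ℚ) : AddCircle (1 : ℚ)) = p ^ (i + 1) :=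
    fun i => addOrderOf_one_div_addCircle (pow_pos hp.pos _)
  have huD : ∀ i, u i ∈ D := fun i => AddCommGroup.mem_primaryComponent.2 ⟨i + 1, by
    simp only [u]
    rw [smul_single]
    have h := addOrderOf_nsmul_eq_zero ((1 / (p ^ (i + 1) : ℕ) : ℚ) : AddCircle (1 : ℚ))
    rw [hord] at h
    rw [h, single_zero]⟩
  have hDk : ∀ d : D, ∃ k : ℕ, p ^ k • d = 0 := fun d => by
    obtain ⟨k, hk⟩ := AddCommGroup.mem_primaryComponent.1 d.2
    exact ⟨k, Subtype.ext hk⟩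
  refine not_isBassian_of_sequence (D := D) x (fun i => ⟨u i, huD i⟩) (fun i => p ^ (i + 1))
    (by simpa using hp.ne_one) (fun c => ⟨fun h i => ?_, fun h => ?_⟩) (fun c => ?_) (fun d => ?_)
    (fun g => exists_extension_of_divisible (divisible_of_primary hp hDk fun d => ?_) _ g)
  · exact prime_pow_dvd_of_linearCombination_mem hp ⊥ x y (fun i => i) hxy hy c h i
  · exact linearCombination_eq_zero_of_dvd x _ hx0 c h
  · rw [linearCombination_codRestrict_eq_zero_iff, linearCombination_single_eq_zero_iff]
    simp_rw [hord]
  · obtain ⟨k, hk⟩ := hDk d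
    refine ⟨k, fun i hi => ?_⟩
    obtain ⟨t, ht⟩ : p ^ k ∣ p ^ (i + 1) := pow_dvd_pow p (by omega)
    rw [ht, mul_comm, mul_smul, hk, smul_zero]
  · obtain ⟨z, hz⟩ := finsupp_addCircle_divisible p hp.ne_zero d
    obtain ⟨k, hk⟩ := hDk d
    refine ⟨⟨z, AddCommGroup.mem_primaryComponent.2 ⟨k + 1, ?_⟩⟩, Subtype.ext hz⟩
    rw [pow_succ, mul_smul, hz]
    exact congrArg Subtype.val hk

/-- Since `P ∩ qB = 0`, the map `g` can be extended on `B ⧸ qB` into the divisible group `Δ`; values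
there are automatically killed by `q`. -/
theorem exists_extension_of_torsion {B Δ : Type*} [AddCommGroup B] [AddCommGroup Δ]
    (hΔ : ∀ n : ℕ, n ≠ 0 → ∀ d : Δ, ∃ y : Δ, n • y = d) (q : ℕ) (P : AddSubgroup B)
    (hP : ∀ x ∈ P, (∃ b, q • b = x) → x = 0) (g : P →+ (nsmulAddMonoidHom (α := Δ) q).ker) :
    ∃ h : B →+ (nsmulAddMonoidHom (α := Δ) q).ker, ∀ x : P, h x = g x := by
  let R : AddSubgroup B := (nsmulAddMonoidHom (α := B) q).range
  obtain ⟨h, hh⟩ := exists_extension_of_ker_le ((QuotientAddGroup.mk' R).comp P.subtype)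
    ((nsmulAddMonoidHom (α := Δ) q).ker.subtype.comp g)
    (exists_extension_of_divisible hΔ _) (fun c hc => by
      have h1 : (c : B) ∈ R := (QuotientAddGroup.eq_zero_iff _).1 hc
      have : c = 0 := Subtype.ext (hP c c.2 h1)
      rw [this, map_zero])
  refine ⟨(h.comp (QuotientAddGroup.mk' R)).codRestrict _ fun b => ?_, fun x => Subtype.ext (hh x)⟩
  rw [AddMonoidHom.mem_ker]
  show q • h (QuotientAddGroup.mk' R b) = 0
  rw [← map_nsmul, ← map_nsmul]
  have : QuotientAddGroup.mk' R (q • b) = 0 := (QuotientAddGroup.eq_zero_iff _).2 ⟨b, rfl⟩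
  rw [this, map_zero]

theorem not_isBassian_of_heightSocle_jump {B : Type*} [AddCommGroup B] {p : ℕ} (hp : p.Prime)
    (j : ℕ) (hinf : (heightSocle B p j : Set B).Infinite)
    (hfin : (heightSocle B p (j + 1) : Set B).Finite) : ¬ IsBassian B := by
  have := countable_addCircle
  let R : AddSubgroup B := (nsmulAddMonoidHom (α := B) (p ^ (j + 1))).range
  obtain ⟨y, hyW, hy⟩ := exists_independent_seq hp R (fun _ => heightSocle B p j)
    (fun i w hw => (mem_heightSocle.1 hw).1) (fun _ => hinf)
    (hfin.subset fun w hw => mem_heightSocle.2 ⟨hw.2, hw.1⟩)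
  obtain ⟨x, hxy, hx0⟩ := exists_smul_eq_of_heightSocle (e := fun _ => j) hyW
  let Δ := ℕ →₀ AddCircle (1 : ℚ)
  let D : AddSubgroup Δ := (nsmulAddMonoidHom (α := Δ) (p ^ (j + 1))).ker
  let u : ℕ → Δ := fun i => single i ((1 / (p ^ (j + 1) : ℕ) : ℚ) : AddCircle (1 : ℚ))
  have hord : addOrderOf ((1 / (p ^ (j + 1) : ℕ) : ℚ) : AddCircle (1 : ℚ)) = p ^ (j + 1) :=
    addOrderOf_one_div_addCircle (pow_pos hp.pos _)
  have huD : ∀ i, u i ∈ D := fun i => by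
    show p ^ (j + 1) • u i = 0
    simp only [u]
    rw [smul_single]
    have h := addOrderOf_nsmul_eq_zero ((1 / (p ^ (j + 1) : ℕ) : ℚ) : AddCircle (1 : ℚ))
    rw [hord] at h
    rw [h, single_zero]
  have hdvd := prime_pow_dvd_of_linearCombination_mem hp R x y (fun _ => j) hxy hy
  have hzero := linearCombination_eq_zero_of_dvd x _ hx0
  refine not_isBassian_of_sequence (D := D) x (fun i => ⟨u i, huD i⟩) (fun i => p ^ (j + 1))
    ?_ (fun c => ⟨fun h i => ?_, fun h => hzero c h⟩) (fun c => ?_) (fun d => ?_)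
    (fun g => exists_extension_of_torsion finsupp_addCircle_divisible _ _ ?_ g)
  · simpa using hp.ne_one
  · exact hdvd c (by rw [h]; exact zero_mem _) i
  · rw [linearCombination_codRestrict_eq_zero_iff, linearCombination_single_eq_zero_iff]
    simp_rw [hord]
  · exact ⟨0, fun i _ => Subtype.ext d.2⟩
  · rintro _ ⟨c, rfl⟩ hb
    exact hzero c fun i => hdvd c hb i

theorem exists_ne_zero_smul_eq_zero {B : Type*} [AddCommGroup B] {p k : ℕ} {x : B} (hx : x ≠ 0)
    (hk : p ^ k • x = 0) : ∃ n, p ^ n • x ≠ 0 ∧ p • p ^ n • x = 0 := by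
  induction k with
  | zero => simp at hk; exact absurd hk hx
  | succ k ih =>
    by_cases h : p ^ k • x = 0
    · exact ih h
    · exact ⟨k, h, by rwa [smul_smul, ← pow_succ']⟩

/-- `V` is divisible, so there is a retraction `π` onto it; the pair is `σ = pπ`, `ι = π`. -/
theorem not_isBassian_of_divisible_primary {B : Type*} [AddCommGroup B] {p : ℕ} (hp : p.Prime)
    (V : AddSubgroup B) (hV : V ≠ ⊥) (ht : ∀ x ∈ V, ∃ k : ℕ, p ^ k • x = 0)
    (hs : ∀ x ∈ V, ∃ y ∈ V, p • y = x) : ¬ IsBassian B := by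
  obtain ⟨π, hπ⟩ := exists_extension_of_divisible (D := V)
    (divisible_of_primary hp (fun x => (ht x x.2).imp fun k hk => Subtype.ext hk)
      (fun x => by
        obtain ⟨y, hy, h⟩ := hs x x.2
        exact ⟨⟨y, hy⟩, Subtype.ext h⟩)) V (AddMonoidHom.id V)
  refine not_isBassian_of_pair ((nsmulAddMonoidHom p).comp π) π V (fun d => ?_) (fun x hx h => ?_) ?_
  · obtain ⟨y, hy, h⟩ := hs d d.2
    refine ⟨y, hy, ?_⟩
    show p • π y = d
    rw [hπ ⟨y, hy⟩]
    exact Subtype.ext h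
  · have := hπ ⟨x, hx⟩
    rw [h] at this
    exact congrArg Subtype.val this.symm
  · obtain ⟨⟨x, hx⟩, hx0⟩ := AddSubgroup.ne_bot_iff_exists_ne_zero.1 hV
    obtain ⟨k, hk⟩ := ht x hx
    obtain ⟨n, h1, h2⟩ := exists_ne_zero_smul_eq_zero (fun h => hx0 (Subtype.ext h)) hk
    refine ⟨p ^ n • x, nsmul_mem hx _, h1, ?_⟩
    show p • π _ = 0
    rw [← map_nsmul, h2, map_zero]

theorem finite_pow_torsion {B : Type*} [AddCommGroup B] {p : ℕ}
    (h : {x : B | p • x = 0}.Finite) (k : ℕ) : {x : B | p ^ k • x = 0}.Finite := by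
  induction k with
  | zero => simp
  | succ k ih =>
    have : {x : B | p ^ (k + 1) • x = 0} = (fun x => p • x) ⁻¹' {x : B | p ^ k • x = 0} := by
      ext x
      simp [pow_succ, mul_smul]
    rw [this]
    refine ih.preimage' fun b _ => ?_
    by_cases hb : ∃ a, p • a = b
    · obtain ⟨a, rfl⟩ := hb
      refine (h.image (fun z => a + z)).subset fun x hx => ⟨x - a, ?_, by simp⟩
      show p • (x - a) = 0
      rw [smul_sub]
      exact sub_eq_zero.2 hx
    · exact Set.finite_empty.subset fun x hx => hb ⟨x, hx⟩

theorem exists_heightSocle_stable {B : Type*} [AddCommGroup B] (p k : ℕ)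
    (hk : (heightSocle B p k : Set B).Finite) :
    ∃ K, ∀ i ≥ K, heightSocle B p i = heightSocle B p K := by
  let f : ℕ → ℕ := fun j => (heightSocle B p (k + j) : Set B).ncard
  refine ⟨k + Function.argmin f, fun i hi => ?_⟩
  have hle := Function.argmin_le f (i - k)
  have hi' : k + (i - k) = i := by omega
  simp only [f, hi'] at hle
  exact SetLike.coe_injective (Set.eq_of_subset_of_ncard_le (heightSocle_antitone B p hi) hle
    (hk.subset (heightSocle_antitone B p (by omega))))

/-- The height socles cannot all be infinite, so they stabilise. A nonzero stable value would make
`p ^ K` times the primary component divisible; hence the component is bounded. An infinite socle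
followed by a finite one is excluded too, so `B[p]` is finite. -/
theorem IsBassian.finite_primaryComponent {B : Type*} [AddCommGroup B] (hB : IsBassian B) {p : ℕ}
    (hp : p.Prime) : (AddCommGroup.primaryComponent B p : Set B).Finite := by
  classical
  have hall : ∃ k, (heightSocle B p k : Set B).Finite := by
    by_contra! h
    exact not_isBassian_of_infinite_heightSocle hp h hB
  obtain ⟨K, hK⟩ := exists_heightSocle_stable p _ hall.choose_spec
  have hbot : heightSocle B p K = ⊥ := by
    by_contra hne
    refine not_isBassian_of_divisible_primary hp
      ((AddCommGroup.primaryComponent B p).map (nsmulAddMonoidHom (p ^ K))) ?_ ?_ ?_ hB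
    · obtain ⟨w, hw⟩ := AddSubgroup.ne_bot_iff_exists_ne_zero.1 hne
      obtain ⟨h1, b, hb⟩ := mem_heightSocle.1 w.2
      intro h
      apply hw
      apply Subtype.ext
      refine (AddSubgroup.eq_bot_iff_forall _).1 h _ ⟨b, ⟨K + 1, ?_⟩, hb⟩
      rw [pow_succ', mul_smul, hb, h1]
    · rintro _ ⟨b, ⟨k, hk⟩, rfl⟩
      refine ⟨k, ?_⟩
      show p ^ k • p ^ K • b = 0
      rw [smul_comm, hk, smul_zero]
    · have key : ∀ n : ℕ, ∀ a : B, (∃ k : ℕ, p ^ k • a = 0) → p ^ n • p ^ K • a = 0 →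
          ∃ b : B, (∃ k : ℕ, p ^ k • b = 0) ∧ p • p ^ K • b = p ^ K • a := by
        intro n
        induction n with
        | zero =>
          intro a _ h
          rw [pow_zero, one_smul] at h
          exact ⟨0, ⟨0, by simp⟩, by simp [h]⟩
        | succ n ih =>
          rintro a ⟨k, hk⟩ h
          have hm : p ^ n • p ^ K • a ∈ heightSocle B p K :=
            mem_heightSocle.2 ⟨by rwa [smul_smul, ← pow_succ'], p ^ n • a, smul_comm _ _ _⟩
          -- Stability raises the height to `K + n + 1`; subtracting `p • b` from `a` then lowers
          -- the exponent to `n`.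
          rw [← hK (K + n + 1) (by omega)] at hm
          obtain ⟨-, b, hb⟩ := mem_heightSocle.1 hm
          have hbT : p ^ (k + (K + n + 1)) • b = 0 := by
            rw [pow_add, mul_smul, hb, smul_comm, smul_comm (p ^ k), hk, smul_zero, smul_zero]
          obtain ⟨c, ⟨l, hl⟩, hc⟩ := ih (a - p • b) ⟨k + (K + n + 1), by
              rw [smul_sub, smul_comm _ p, hbT, smul_zero, sub_zero, add_comm, pow_add, mul_smul,
                hk, smul_zero]⟩ (by
              rw [smul_sub, smul_sub, sub_eq_zero, ← hb, smul_smul, smul_smul]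
              congr 1
              ring)
          refine ⟨b + c, ⟨l + (k + (K + n + 1)), ?_⟩, ?_⟩
          · rw [smul_add, pow_add, mul_smul, hbT, smul_zero, zero_add, mul_comm, mul_smul, hl,
              smul_zero]
          · rw [smul_add, smul_add, hc, smul_sub, smul_comm p]
            abel
      rintro _ ⟨a, ⟨k, hk⟩, rfl⟩
      obtain ⟨b, hb, hba⟩ := key k a ⟨k, hk⟩ (by rw [smul_comm, hk, smul_zero])
      exact ⟨p ^ K • b, ⟨b, hb, rfl⟩, hba⟩
  have hbdd : ∀ x ∈ AddCommGroup.primaryComponent B p, p ^ K • x = 0 := by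
    rintro x ⟨k, hk⟩
    by_contra hne
    obtain ⟨n, h1, h2⟩ := exists_ne_zero_smul_eq_zero (k := k) hne (by
      rw [smul_comm, hk, smul_zero])
    refine h1 ((AddSubgroup.eq_bot_iff_forall _).1 hbot _ (mem_heightSocle.2 ⟨h2, p ^ n • x, ?_⟩))
    exact smul_comm _ _ _
  have hW0 : (heightSocle B p 0 : Set B).Finite := by
    by_contra h0
    have hpos : Nat.find hall ≠ 0 := fun h => h0 (h ▸ Nat.find_spec hall)
    obtain ⟨j, hj⟩ := Nat.exists_eq_succ_of_ne_zero hpos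
    exact not_isBassian_of_heightSocle_jump hp j (Nat.find_min hall (by omega))
      (by have := Nat.find_spec hall; rwa [hj] at this) hB
  refine (finite_pow_torsion (hW0.subset fun x hx => ?_) K).subset hbdd
  exact mem_heightSocle.2 ⟨hx, x, by simp⟩

end BassianPrimary

/-! ### Pigeonhole arguments and the splitting of `N`. -/

section Main

theorem IsBassian.rank_lt_aleph0 {B : Type*} [AddCommGroup B] (hB : IsBassian B) :
    Module.rank ℤ B < Cardinal.aleph0 := by
  by_contra! h
  obtain ⟨s, hs, hli⟩ := exists_set_linearIndependent ℤ B
  rw [← hs, ← Cardinal.infinite_iff] at h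
  exact not_isBassian_of_linearIndependent _ (hli.comp _ (Infinite.natEmbedding s).injective) hB

theorem IsBPlusEGroup.rank_lt_aleph0 {G : Type*} [AddCommGroup G] (hG : IsBPlusEGroup G) :
    Module.rank ℤ G < Cardinal.aleph0 := by
  obtain ⟨B, E, hBE, hB, hE⟩ := hG
  have hc : IsCompl (AddSubgroup.toIntSubmodule B) (AddSubgroup.toIntSubmodule E) :=
    (AddSubgroup.toIntSubmodule (M := G)).isCompl_iff.1 hBE
  have hrank : Module.rank ℤ (AddSubgroup.toIntSubmodule E) = 0 := by
    rw [rank_eq_zero_iff]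
    intro x
    obtain ⟨n, hn, hx⟩ := isOfFinAddOrder_iff_nsmul_eq_zero.1 (hE.1 x)
    exact ⟨n, by exact_mod_cast hn.ne', by rw [natCast_zsmul]; exact hx⟩
  rw [← HasRankNullity.rank_quotient_add_rank (AddSubgroup.toIntSubmodule E), hrank, add_zero,
    (Submodule.quotientEquivOfIsCompl _ _ hc.symm).rank_eq]
  exact hB.rank_lt_aleph0

theorem isAddTorsion_of_injective_quotient {G : Type*} [AddCommGroup G]
    (hG : Module.rank ℤ G < Cardinal.aleph0) {N : AddSubgroup G} (f : G →+ G ⧸ N)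
    (hf : Function.Injective f) : ∀ x ∈ N, ∃ n : ℕ, 0 < n ∧ n • x = 0 := by
  let N' := AddSubgroup.toIntSubmodule N
  have h1 : Module.rank ℤ G ≤ Module.rank ℤ (G ⧸ N') :=
    LinearMap.rank_le_of_injective (M₁ := G ⧸ N') f.toIntLinearMap hf
  have h2 := HasRankNullity.rank_quotient_add_rank N'
  have h3 : Module.rank ℤ N' = 0 := by
    have hlt : Module.rank ℤ (G ⧸ N') < Cardinal.aleph0 :=
      lt_of_le_of_lt (h2 ▸ self_le_add_right _ _) hG
    have h4 : Module.rank ℤ N' + Module.rank ℤ (G ⧸ N') ≤ 0 + Module.rank ℤ (G ⧸ N') := by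
      rw [add_comm, h2, zero_add]; exact h1
    exact le_antisymm ((Cardinal.add_le_add_iff_of_lt_aleph0 hlt).1 h4) zero_le
  intro x hx
  obtain ⟨a, ha, hax⟩ := rank_eq_zero_iff.1 h3 ⟨x, hx⟩
  have hax' : a • x = 0 := congrArg Subtype.val hax
  refine ⟨a.natAbs, Int.natAbs_pos.2 ha, ?_⟩
  rw [← natCast_zsmul]
  rcases Int.natAbs_eq a with h | h
  · rwa [← h]
  · rw [h, neg_smul] at hax'
    simpa using hax'

/-- Multiplication by `p` kills the elementary part, so these elements are `p` times elements of the
finite `p`-primary component of `B`. -/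
theorem IsBPlusEGroup.finite_divisible_primary {G : Type*} [AddCommGroup G] (hG : IsBPlusEGroup G)
    {p : ℕ} (hp : p.Prime) :
    {x : G | (∃ y, p • y = x) ∧ ∃ k : ℕ, p ^ k • x = 0}.Finite := by
  obtain ⟨B, E, hBE, hB, hE⟩ := hG
  refine ((hB.finite_primaryComponent hp).image fun b : B => p • (b : G)).subset ?_
  rintro _ ⟨⟨y, rfl⟩, k, hk⟩
  obtain ⟨b, hb, e, he, rfl⟩ := AddSubgroup.mem_sup.1
    (show y ∈ B ⊔ E by rw [hBE.sup_eq_top]; trivial)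
  rw [smul_smul, ← pow_succ, smul_add] at hk
  have hb0 : p ^ (k + 1) • b = 0 := by
    refine AddSubgroup.disjoint_def.1 hBE.disjoint (nsmul_mem hb _) ?_
    rw [eq_neg_of_add_eq_zero_left hk]
    exact neg_mem (nsmul_mem he _)
  rw [hb0, zero_add] at hk
  have hpe : p • e = 0 := congrArg Subtype.val
    (hE.2 p hp ⟨e, he⟩ (AddCommGroup.mem_primaryComponent.2 ⟨k + 1, Subtype.ext hk⟩))
  refine ⟨⟨b, hb⟩, AddCommGroup.mem_primaryComponent.2 ⟨k + 1, Subtype.ext hb0⟩, ?_⟩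
  simp [smul_add, hpe]

theorem eq_zero_of_injective_of_finite {G : Type*} [AddCommGroup G] {N : AddSubgroup G}
    (f : G →+ G ⧸ N) (hf : Function.Injective f) (X : Set G) (hX : X.Finite) (h0 : 0 ∈ X)
    (h : ∀ x ∈ X, ∃ y ∈ X, f x = (y : G ⧸ N)) (x : G) (hxX : x ∈ X) (hxN : x ∈ N) : x = 0 := by
  have hsub : f '' X ⊆ (fun y : G => (y : G ⧸ N)) '' X := by
    rintro _ ⟨x, hx, rfl⟩
    obtain ⟨y, hy, hxy⟩ := h x hx
    exact ⟨y, hy, hxy.symm⟩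
  have h1 := Set.ncard_le_ncard hsub (hX.image _)
  rw [Set.ncard_image_of_injective X hf] at h1
  have hinj := (Set.ncard_image_iff hX).1 (le_antisymm (Set.ncard_image_le hX) h1)
  refine hinj hxX h0 ?_
  simpa using (QuotientAddGroup.eq_zero_iff x).2 hxN

/-- Lifts of `p`-primary elements of `G ⧸ N` can be taken `p`-primary: Bézout gives a multiple `r •
g` in the same coset. -/
theorem exists_zsmul_primary {G : Type*} [AddCommGroup G] {N : AddSubgroup G}
    (hN : ∀ x ∈ N, ∃ n : ℕ, 0 < n ∧ n • x = 0) {p : ℕ} (hp : p.Prime) (a : ℕ) (g : G)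
    (hg : p ^ a • g ∈ N) : ∃ r : ℤ, g - r • g ∈ N ∧ ∃ k : ℕ, p ^ k • r • g = 0 := by
  obtain ⟨n, hn, hng⟩ := hN _ hg
  obtain ⟨c, m, hm, rfl⟩ := Nat.exists_eq_pow_mul_and_not_dvd hn.ne' p hp.ne_one
  obtain ⟨u, v, huv⟩ : IsCoprime (m : ℤ) ((p ^ a : ℕ) : ℤ) := Nat.isCoprime_iff_coprime.2
    (((Nat.Prime.coprime_iff_not_dvd hp).2 hm).symm.pow_right a)
  refine ⟨u * m, ?_, c + a, ?_⟩
  · have : g - (u * m) • g = v • p ^ a • g := by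
      rw [← natCast_zsmul g, smul_smul, eq_comm, eq_sub_iff_add_eq, add_comm, ← add_smul, huv,
        one_smul]
    rw [this]
    exact zsmul_mem hg _
  · have : p ^ (c + a) • (u * m : ℤ) • g = u • (p ^ c * m) • p ^ a • g := by
      simp only [← natCast_zsmul, smul_smul]
      congr 1
      push_cast
      ring
    rw [this, hng, smul_zero]

theorem eq_zero_of_mem_of_divisible_primary {G : Type*} [AddCommGroup G] (hG : IsBPlusEGroup G)
    {N : AddSubgroup G} (f : G →+ G ⧸ N) (hf : Function.Injective f) {p : ℕ} (hp : p.Prime) (x : G)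
    (hx : x ∈ N) (hdiv : ∃ y, p • y = x) (hk : ∃ k : ℕ, p ^ k • x = 0) : x = 0 := by
  have hN := isAddTorsion_of_injective_quotient hG.rank_lt_aleph0 f hf
  refine eq_zero_of_injective_of_finite f hf _ (hG.finite_divisible_primary hp)
    ⟨⟨0, smul_zero _⟩, 0, smul_zero _⟩ ?_ x ⟨hdiv, hk⟩ hx
  rintro _ ⟨⟨y, rfl⟩, k, hk⟩
  obtain ⟨g, hg⟩ := QuotientAddGroup.mk_surjective (f y)
  have hgN : p ^ (k + 1) • g ∈ N := by
    rw [← QuotientAddGroup.eq_zero_iff, QuotientAddGroup.mk_nsmul, hg, ← map_nsmul, pow_succ,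
      mul_smul, hk, map_zero]
  obtain ⟨r, hr, l, hl⟩ := exists_zsmul_primary hN hp _ g hgN
  refine ⟨p • r • g, ⟨⟨_, rfl⟩, l, by rw [smul_comm, hl, smul_zero]⟩, ?_⟩
  rw [map_nsmul, ← hg, QuotientAddGroup.mk_nsmul]
  congr 1
  rw [← sub_eq_zero, ← QuotientAddGroup.mk_sub, QuotientAddGroup.eq_zero_iff]
  exact hr

theorem squarefree_lcm {m n : ℕ} (hm : Squarefree m) (hn : Squarefree n) :
    Squarefree (m.lcm n) := by
  have h0 := Nat.lcm_ne_zero hm.ne_zero hn.ne_zero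
  rw [Nat.squarefree_iff_factorization_le_one h0, Nat.factorization_lcm hm.ne_zero hn.ne_zero]
  intro p
  exact sup_le ((Nat.squarefree_iff_factorization_le_one hm.ne_zero).1 hm p)
    ((Nat.squarefree_iff_factorization_le_one hn.ne_zero).1 hn p)

/-- The subgroup of elements of squarefree order. -/
def squarefreeTorsion (A : Type*) [AddCommGroup A] : AddSubgroup A where
  carrier := {x | ∃ m : ℕ, Squarefree m ∧ m • x = 0}
  zero_mem' := ⟨1, squarefree_one, smul_zero _⟩
  neg_mem' := by
    rintro x ⟨m, hm, hx⟩
    exact ⟨m, hm, by rw [smul_neg, hx, neg_zero]⟩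
  add_mem' := by
    rintro x y ⟨m, hm, hx⟩ ⟨n, hn, hy⟩
    obtain ⟨s, hs⟩ := Nat.dvd_lcm_left m n
    obtain ⟨t, ht⟩ := Nat.dvd_lcm_right m n
    refine ⟨m.lcm n, squarefree_lcm hm hn, ?_⟩
    rw [smul_add]
    nth_rewrite 1 [hs]
    rw [ht, mul_comm m, mul_comm n, mul_smul, mul_smul, hx, hy, smul_zero, smul_zero, add_zero]

theorem isElementaryGroup_squarefreeTorsion (A : Type*) [AddCommGroup A] :
    IsElementaryGroup (squarefreeTorsion A) :=
  isElementaryGroup_iff.2 fun x => by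
    obtain ⟨m, hm, hx⟩ := x.2
    exact ⟨m, hm, Subtype.ext hx⟩

/-- The image of `A[p]` in the elementary group `A ⧸ pA` is finite, and the fibres are cosets of the
finite group `A[p] ∩ pA`. -/
theorem finite_prime_torsion {A : Type*} [AddCommGroup A]
    (hA : ∀ S : AddSubgroup A, IsElementaryGroup S → IsDirectSummand S → Finite S) {p : ℕ}
    (hp : p.Prime) (hfin : {x : A | (∃ y, p • y = x) ∧ p • x = 0}.Finite) :
    {x : A | p • x = 0}.Finite := by
  let R : AddSubgroup A := (nsmulAddMonoidHom (α := A) p).range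
  let S : AddSubgroup A := (nsmulAddMonoidHom (α := A) p).ker
  have hpsq : Squarefree p := (Nat.prime_iff.1 hp).squarefree
  have hW : IsElementaryGroup (A ⧸ R) := isElementaryGroup_of_squarefree hpsq fun x => by
    obtain ⟨a, rfl⟩ := QuotientAddGroup.mk_surjective x
    rw [← QuotientAddGroup.mk_nsmul, QuotientAddGroup.eq_zero_iff]
    exact ⟨a, rfl⟩
  have hS : IsElementaryGroup S :=
    isElementaryGroup_of_squarefree hpsq fun x => Subtype.ext x.2
  have himage := finite_map_of_finite_elementary_summands hA hW (QuotientAddGroup.mk' R) S hS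
  refine Set.Finite.of_finite_fibers (QuotientAddGroup.mk' R)
    (Set.toFinite ((S.map (QuotientAddGroup.mk' R) : AddSubgroup (A ⧸ R)) : Set (A ⧸ R))) ?_
  rintro _ ⟨s, hs, rfl⟩
  have hs' : p • s = 0 := hs
  refine (hfin.image fun z => s + z).subset ?_
  rintro x ⟨hx, hxs⟩
  have hx' : p • x = 0 := hx
  refine ⟨x - s, ⟨?_, by rw [smul_sub, hx', hs', sub_zero]⟩, by simp⟩
  have : x - s ∈ R := by
    rw [← QuotientAddGroup.eq_zero_iff, QuotientAddGroup.mk_sub, sub_eq_zero]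
    exact hxs
  exact this

theorem exists_prime_smul_of_torsion {G : Type*} [AddCommGroup G] {x : G} (hx : x ≠ 0)
    (hfin : ∃ n : ℕ, 0 < n ∧ n • x = 0) : ∃ p t : ℕ, p.Prime ∧ t • x ≠ 0 ∧ p • t • x = 0 := by
  have hpos : 0 < addOrderOf x := (isOfFinAddOrder_iff_nsmul_eq_zero.2 hfin).addOrderOf_pos
  have h1 : addOrderOf x ≠ 1 := fun h => hx (AddMonoid.addOrderOf_eq_one_iff.1 h)
  obtain ⟨p, hp, t, ht⟩ := Nat.exists_prime_and_dvd h1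
  refine ⟨p, t, hp, fun h => ?_, by rw [smul_smul, ← ht, addOrderOf_nsmul_eq_zero]⟩
  have ht0 : 0 < t := Nat.pos_of_ne_zero fun h => by rw [h, mul_zero] at ht; omega
  have := Nat.le_of_dvd ht0 (addOrderOf_dvd_of_nsmul_eq_zero h)
  have := hp.two_le
  nlinarith

theorem theorem3p7 {G : Type*} [AddCommGroup G] (hG : IsBPlusEGroup G)
    (A E : AddSubgroup G) (hAE : IsCompl A E) (hE : IsElementaryGroup E)
    (hA : ∀ S : AddSubgroup A, IsElementaryGroup S → IsDirectSummand S → Finite S) :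
    IsGeneralizedBassian G := by
  classical
  rintro N ⟨f, hf⟩
  have hN := isAddTorsion_of_injective_quotient hG.rank_lt_aleph0 f hf
  have hNp := fun {p : ℕ} (hp : p.Prime) => eq_zero_of_mem_of_divisible_primary hG f hf hp
  have hGA : IsElementaryGroup (G ⧸ A) :=
    hE.of_surjective ((QuotientAddGroup.mk' A).comp E.subtype) fun x => by
      obtain ⟨g, rfl⟩ := QuotientAddGroup.mk_surjective x
      obtain ⟨a, ha, e, he, rfl⟩ := AddSubgroup.mem_sup.1
        (show g ∈ A ⊔ E by rw [hAE.sup_eq_top]; trivial)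
      refine ⟨⟨e, he⟩, ?_⟩
      show ((e : G) : G ⧸ A) = _
      rw [QuotientAddGroup.mk_add, (QuotientAddGroup.eq_zero_iff a).2 ha, zero_add]
  have hGNA : IsElementaryGroup (G ⧸ (N ⊔ A)) :=
    hGA.of_surjective (QuotientAddGroup.map A (N ⊔ A) (AddMonoidHom.id G) le_sup_right) fun x => by
      obtain ⟨g, rfl⟩ := QuotientAddGroup.mk_surjective x
      exact ⟨g, rfl⟩
  let θ : G ⧸ N →+ G ⧸ (N ⊔ A) := QuotientAddGroup.map N (N ⊔ A) (AddMonoidHom.id G) le_sup_left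
  let ψ : A →+ G ⧸ (N ⊔ A) := (θ.comp f).comp A.subtype
  have hψ := finite_map_of_finite_elementary_summands hA hGNA ψ (squarefreeTorsion A)
    (isElementaryGroup_squarefreeTorsion A)
  have hAp : ∀ {p : ℕ}, p.Prime → {x : G | x ∈ A ∧ p • x = 0}.Finite := by
    intro p hp
    have hfin := finite_prime_torsion hA hp <|
      ((hG.finite_divisible_primary hp).preimage Subtype.val_injective.injOn).subset <| by
        rintro x ⟨⟨y, hy⟩, hx⟩
        exact ⟨⟨y, congrArg Subtype.val hy⟩, 1, by rw [pow_one]; exact congrArg Subtype.val hx⟩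
    exact (hfin.image Subtype.val).subset fun x hx => ⟨⟨x, hx.1⟩, Subtype.ext hx.2, rfl⟩
  let M := Nat.card ((squarefreeTorsion A).map ψ)
  have hM : M ≠ 0 := Nat.card_pos.ne'
  have hNA : ∀ {p : ℕ}, p.Prime → ¬ p ∣ M → ∀ x ∈ N, x ∈ A → p • x = 0 → x = 0 := by
    intro p hp hpM x hxN hxA hpx
    refine eq_zero_of_injective_of_finite f hf _ (hAp hp) ⟨zero_mem _, smul_zero _⟩ ?_ x
      ⟨hxA, hpx⟩ hxN
    rintro a ⟨haA, hpa⟩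
    -- The order of `θ (f a)` divides both `M` and `p`.
    have hψa : θ (f a) = 0 := by
      have hmem : ψ ⟨a, haA⟩ ∈ (squarefreeTorsion A).map ψ :=
        ⟨⟨a, haA⟩, ⟨p, (Nat.prime_iff.1 hp).squarefree, Subtype.ext hpa⟩, rfl⟩
      have h1 : M • θ (f a) = 0 := congrArg Subtype.val
        (card_nsmul_eq_zero' (x := (⟨_, hmem⟩ : (squarefreeTorsion A).map ψ)))
      have h2 : p • θ (f a) = 0 := by rw [← map_nsmul, ← map_nsmul, hpa, map_zero, map_zero]
      have h3 := Nat.dvd_gcd (addOrderOf_dvd_of_nsmul_eq_zero h1)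
        (addOrderOf_dvd_of_nsmul_eq_zero h2)
      rw [Nat.Coprime.gcd_eq_one ((Nat.Prime.coprime_iff_not_dvd hp).2 hpM).symm] at h3
      exact AddMonoid.addOrderOf_eq_one_iff.1 (Nat.dvd_one.1 h3)
    obtain ⟨g, hg⟩ := QuotientAddGroup.mk_surjective (f a)
    rw [← hg] at hψa
    have hgNA : g ∈ N ⊔ A := (QuotientAddGroup.eq_zero_iff g).1 hψa
    obtain ⟨n, hn, b, hb, rfl⟩ := AddSubgroup.mem_sup.1 hgNA
    rw [QuotientAddGroup.mk_add, (QuotientAddGroup.eq_zero_iff n).2 hn, zero_add] at hg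
    have hpb : p • b ∈ N := by
      rw [← QuotientAddGroup.eq_zero_iff, QuotientAddGroup.mk_nsmul, hg, ← map_nsmul, hpa,
        map_zero]
    obtain ⟨r, hr, k, hk⟩ := exists_zsmul_primary hN hp 1 b (by rwa [pow_one])
    -- `p • r • b` is `p`-primary and lies in `N ∩ pG`, hence vanishes; so this lift belongs to
    -- `A[p]`.
    refine ⟨r • b, ⟨zsmul_mem hb _, ?_⟩, ?_⟩
    · exact hNp hp _ (by rw [smul_comm]; exact zsmul_mem hpb _) ⟨_, rfl⟩
        ⟨k, by rw [smul_comm, hk, smul_zero]⟩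
    · rw [← hg, ← sub_eq_zero, ← QuotientAddGroup.mk_sub, QuotientAddGroup.eq_zero_iff]
      exact hr
  let m := ∏ p ∈ M.primeFactors, p
  have hm : Squarefree m := Finset.squarefree_prod_of_pairwise_isCoprime
    (fun p hp q hq hpq => (Nat.coprime_iff_isRelPrime.1 ((Nat.coprime_primes
      (Nat.prime_of_mem_primeFactors hp) (Nat.prime_of_mem_primeFactors hq)).2 hpq)))
    (fun p hp => (Nat.prime_iff.1 (Nat.prime_of_mem_primeFactors hp)).squarefree)
  let R : AddSubgroup G := (nsmulAddMonoidHom (α := G) m).range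
  have hW : IsElementaryGroup (G ⧸ R) := isElementaryGroup_of_squarefree hm fun x => by
    obtain ⟨a, rfl⟩ := QuotientAddGroup.mk_surjective x
    rw [← QuotientAddGroup.mk_nsmul, QuotientAddGroup.eq_zero_iff]
    exact ⟨a, rfl⟩
  refine isDirectSummand_of_disjoint_ker (hGA.prod hW)
    ((QuotientAddGroup.mk' A).prod (QuotientAddGroup.mk' R)) N fun x hxN hx => ?_
  by_contra hx0
  have hxA : x ∈ A := (QuotientAddGroup.eq_zero_iff x).1 (congrArg Prod.fst hx)
  have hxR : x ∈ R := (QuotientAddGroup.eq_zero_iff x).1 (congrArg Prod.snd hx)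
  obtain ⟨p, t, hp, ht0, hpt⟩ := exists_prime_smul_of_torsion hx0 (hN x hxN)
  apply ht0
  by_cases hpM : p ∣ M
  · refine hNp hp _ (nsmul_mem hxN t) ?_ ⟨1, by rwa [pow_one]⟩
    obtain ⟨y, hy⟩ := nsmul_mem hxR t
    obtain ⟨q, hq⟩ : p ∣ m :=
      Finset.dvd_prod_of_mem (fun p => p) (Nat.mem_primeFactors.2 ⟨hp, hpM, hM⟩)
    refine ⟨q • y, ?_⟩
    rw [smul_smul, ← hq]
    exact hy
  · exact hNA hp hpM _ (nsmul_mem hxN t) (nsmul_mem hxA t) hpt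

end Main
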